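/- For positive integers $m,n,p,k$ and an $m$-tuple $\mathbf A=(A_1,\dots,A_m)$ of complex $n\times n$ matrices, let the joint rank $(k:p)$-matricial range $\Lambda_{(k:p)}(\mathbf A)$ be the set of all $m$-tuples $(D_1,\dots,D_m)$ of complex diagonal $p\times p$ matrices for which there is a complex $n\times kp$ matrix $V$ with $V^*V=I_{kp}$ and $V^*A_jV=D_j\otimes I_k$ for $j=1,\dots,m$. For $p=1$, the $1\times 1$ matrices $D_j$ are identified with scalars. Theorem. Let $m,p,k\ge 1$, let $\mathbf A=(A_1,\dots,A_m)$ be an $m$-tuple of Hermitian complex $n\times n$ matrices, and suppose that $n\ge (kp(m+2)-1)(m+1)^2$. Then $\Lambda_{(kp(m+2):1)}(\mathbf A)$ is non-empty. Moreover, for every $(a_1,\dots,a_m)\in\Lambda_{(kp(m+2):1)}(\mathbf A)$, the set $\Lambda_{(k:p)}(\mathbf A)$ is star-shaped with star center $(a_1I_p,\dots,a_mI_p)$; that is, $(a_1I_p,\dots,a_mI_p)\in\Lambda_{(k:p)}(\mathbf A)$ and $$t(a_1I_p,\dots,a_mI_p)+(1-t)(B_1,\dots,B_m)\in\Lambda_{(k:p)}(\mathbf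 A)$$ for all $t\in[0,1]$ and all $(B_1,\dots,B_m)\in\Lambda_{(k:p)}(\mathbf A)$. -/

import Mathlib

open scoped Matrix Kronecker

/-- The joint rank `(k : p)`-matricial range of an `m`-tuple `A` of complex `n × n` matrices:
the set of `m`-tuples `D` of diagonal `p × p` matrices for which there is an `n × kp` matrix `V`
(columns indexed by `Fin p × Fin k`, as for the Kronecker product) with orthonormal columns,
`Vᴴ V = I`, such that `Vᴴ A_j V = D_j ⊗ I_k` for every `j`. -/
def jointMatricialRange {m n : ℕ} (k p : ℕ) (A : Fin m → Matrix (Fin n) (Fin n) ℂ) :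
    Set (Fin m → Matrix (Fin p) (Fin p) ℂ) :=
  {D | (∀ j, (D j).IsDiag) ∧
    ∃ V : Matrix (Fin n) (Fin p × Fin k) ℂ,
      Vᴴ * V = 1 ∧ ∀ j, Vᴴ * A j * V = D j ⊗ₖ (1 : Matrix (Fin k) (Fin k) ℂ)}

/-- The tuple `(a_1 I_p, …, a_m I_p)` of scalar matrices. For `p = 1` this is the usual
identification of the tuple of scalars `a` with a tuple of `1 × 1` matrices. -/
def scalarTuple {m : ℕ} (p : ℕ) (a : Fin m → ℂ) : Fin m → Matrix (Fin p) (Fin p) ℂ :=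
  fun j => a j • (1 : Matrix (Fin p) (Fin p) ℂ)

/-! Non-emptiness: put K = kp(m+2) - 1. Greedy orthogonalisation compresses all A_j to diagonal
matrices of size K(m+1)+1, hence to that many points of ℝ^m. Tverberg's theorem splits them into K+1
classes whose hulls share a point q; square roots of the convex weights give K+1 orthonormal vectors
of disjoint support, on which A_j compresses to the scalar q_j.

Star-shapedness: given V for B, the scalar compression of size kp(m+2) has room for an isometry W
with columns orthogonal to those of V and of every A_j V. Then √t W + √(1-t) V has no cross terms
and realises the convex combination. -/

open scoped InnerProductSpace in
/-- If the angle condition `⟪z, y⟫ < ‖z‖²` holds, the segment from `z` to `y` contains points of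
norm smaller than `‖z‖`. -/
theorem exists_mem_segment_norm_lt {E : Type*} [NormedAddCommGroup E] [InnerProductSpace ℝ E]
    {z y : E} (h : ⟪z, y⟫_ℝ < ‖z‖ ^ 2) : ∃ x ∈ segment ℝ z y, ‖x‖ < ‖z‖ := by
  by_contra! hmin
  have hK : Convex ℝ (segment ℝ z y) := convex_segment z y
  have hz : z ∈ segment ℝ z y := left_mem_segment ℝ z y
  have : ‖(0 : E) - z‖ = ⨅ w : segment ℝ z y, ‖(0 : E) - w‖ := by
    have : Nonempty (segment ℝ z y) := ⟨⟨z, hz⟩⟩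
    apply le_antisymm
    · refine le_ciInf fun w => ?_
      simpa using hmin w w.2
    · exact ciInf_le ⟨0, by rintro _ ⟨w, rfl⟩; positivity⟩ (⟨z, hz⟩ : segment ℝ z y)
  have h1 := (norm_eq_iInf_iff_real_inner_le_zero hK hz).1 this y (right_mem_segment ℝ z y)
  rw [zero_sub, inner_neg_left, inner_sub_right, real_inner_self_eq_norm_sq] at h1
  linarith

open scoped InnerProductSpace in
/-- Bárány's colorful Carathéodory theorem. -/
theorem colorful_caratheodory {E ι κ : Type*} [NormedAddCommGroup E] [InnerProductSpace ℝ E]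
    [FiniteDimensional ℝ E] [Fintype ι] [Finite κ] (hcard : Module.finrank ℝ E < Fintype.card ι)
    (w : ι → κ → E) (hw : ∀ i, (0 : E) ∈ convexHull ℝ (Set.range (w i))) :
    ∃ c : ι → κ, (0 : E) ∈ convexHull ℝ (Set.range fun i => w i (c i)) := by
  classical
  have hι : Nonempty ι := Fintype.card_pos_iff.1 (by omega)
  have hκ : Nonempty κ := by
    obtain ⟨i⟩ := hι
    exact Set.range_nonempty_iff_nonempty.1 (convexHull_nonempty_iff.1 ⟨0, hw i⟩)
  have hmin (c : ι → κ) : ∃ z ∈ convexHull ℝ (Set.range fun i => w i (c i)),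
      ∀ y ∈ convexHull ℝ (Set.range fun i => w i (c i)), ‖z‖ ≤ ‖y‖ :=
    ((Set.finite_range fun i => w i (c i)).isCompact_convexHull (𝕜 := ℝ)).exists_isMinOn
      (Set.range_nonempty _).convexHull continuous_norm.continuousOn
  choose z hz hzmin using hmin
  -- Take a colour choice whose hull comes nearest to 0, and suppose the distance is positive.
  obtain ⟨c, hc⟩ := Finite.exists_min fun c => ‖z c‖
  refine ⟨c, ?_⟩
  by_cases hz0 : z c = 0
  · exact hz0 ▸ hz c
  exfalso
  have hlow (y : E) (hy : y ∈ convexHull ℝ (Set.range fun i => w i (c i))) :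
      ‖z c‖ ^ 2 ≤ ⟪z c, y⟫_ℝ := by
    by_contra! hlt
    obtain ⟨x, hx, hxlt⟩ := exists_mem_segment_norm_lt hlt
    exact absurd (hzmin c x ((convex_convexHull ℝ _).segment_subset (hz c) hy hx)) (not_le.2 hxlt)
  obtain ⟨τ, _, y, l, hys, hyind, hlpos, hlsum, hly⟩ := eq_pos_convex_span_of_mem_convexHull (hz c)
  have hface (r : τ) : ⟪z c, y r⟫_ℝ = ‖z c‖ ^ 2 := by
    have hsum : ∑ r, l r * (⟪z c, y r⟫_ℝ - ‖z c‖ ^ 2) = 0 := by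
      have : ⟪z c, ∑ r, l r • y r⟫_ℝ = ‖z c‖ ^ 2 := by rw [hly, real_inner_self_eq_norm_sq]
      simp only [inner_sum, inner_smul_right] at this
      simp only [mul_sub, Finset.sum_sub_distrib, ← Finset.sum_mul, this, hlsum, one_mul, sub_self]
    have hnn := (Finset.sum_eq_zero_iff_of_nonneg fun r _ => mul_nonneg (hlpos r).le
      (sub_nonneg.2 (hlow _ (subset_convexHull ℝ _ (hys ⟨r, rfl⟩))))).1 hsum r (Finset.mem_univ r)
    exact sub_eq_zero.1 ((mul_eq_zero.1 hnn).resolve_left (hlpos r).ne')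
  -- Affinely independent points on a hyperplane missing 0 are linearly independent, so they number
  -- at most dim E and some colour `i₀` is unused. Recolouring `i₀` keeps `z c` in the hull.
  have hlin : LinearIndependent ℝ y := by
    rw [Fintype.linearIndependent_iff]
    intro g hg
    have hg0 : ∑ r, g r = 0 := by
      have : ⟪z c, ∑ r, g r • y r⟫_ℝ = 0 := by rw [hg, inner_zero_right]
      simp only [inner_sum, inner_smul_right, hface, ← Finset.sum_mul] at this
      exact (mul_eq_zero.1 this).resolve_right (by positivity)
    exact fun r => affineIndependent_iff.1 hyind Finset.univ g hg0 hg r (Finset.mem_univ r)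
  choose i hi using fun r => hys ⟨r, rfl⟩
  have hnsurj : ¬ Function.Surjective i := fun hs => by
    have h1 := Fintype.card_le_of_surjective i hs
    have h2 := hlin.fintype_card_le_finrank
    omega
  obtain ⟨i₀, hi₀⟩ : ∃ i₀, ∀ r, i r ≠ i₀ := by simpa [Function.Surjective] using hnsurj
  obtain ⟨s, hs⟩ : ∃ s, ⟪z c, w i₀ s⟫_ℝ ≤ 0 := by
    by_contra! hpos
    have hconv : Convex ℝ {x : E | 0 < ⟪z c, x⟫_ℝ} :=
      convex_halfSpace_gt (innerₗ E (z c)).isLinear 0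
    have h0 := convexHull_min (by rintro _ ⟨s, rfl⟩; exact hpos s) hconv (hw i₀)
    simp at h0
  obtain ⟨x, hx, hxlt⟩ := exists_mem_segment_norm_lt (z := z c) (y := w i₀ s)
    (hs.trans_lt (by positivity))
  let c' := Function.update c i₀ s
  have hzc' : z c ∈ convexHull ℝ (Set.range fun i => w i (c' i)) := by
    rw [← hly]
    refine (convex_convexHull ℝ _).sum_mem (fun r _ => (hlpos r).le) hlsum fun r _ => ?_
    refine subset_convexHull ℝ _ ⟨i r, ?_⟩
    simpa [c', Function.update_of_ne (hi₀ r)] using hi r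
  have hsc' : w i₀ s ∈ convexHull ℝ (Set.range fun i => w i (c' i)) :=
    subset_convexHull ℝ _ ⟨i₀, by simp [c']⟩
  have h1 := hzmin c' x ((convex_convexHull ℝ _).segment_subset hzc' hsc' hx)
  have h2 := hc c'
  linarith

/-- Tverberg's theorem: more than `K (d + 1)` points of `ℝ^d` can be split into `K + 1` classes
whose convex hulls share a point. -/
theorem tverberg {ι τ : Type*} [Fintype ι] [Fintype τ] (K : ℕ)
    (hcard : K * (Fintype.card τ + 1) < Fintype.card ι) (x : ι → τ → ℝ) :
    ∃ (c : ι → Fin (K + 1)) (l : ι → ℝ) (q : τ → ℝ), (∀ i, 0 ≤ l i) ∧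
      (∀ s, ∑ i with c i = s, l i = 1) ∧ ∀ s b, ∑ i with c i = s, l i * x i b = q b := by
  classical
  -- Sarkaria's trick: tensor the homogenised points with K+1 vectors of ℝ^K whose only linear
  -- relation, up to scale, is that their sum is 0.
  let X : ι → Option τ → ℝ := fun i b => b.elim 1 (x i)
  let w : ι → Fin (K + 1) → EuclideanSpace ℝ (Fin K × Option τ) := fun i s =>
    WithLp.toLp 2 fun rb => (if s = rb.1.succ then X i rb.2 else 0) - if s = 0 then X i rb.2 else 0
  have hw (i : ι) : (0 : EuclideanSpace ℝ (Fin K × Option τ)) ∈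
      convexHull ℝ (Set.range (w i)) := by
    have hsum : ∑ s, ((K : ℝ) + 1)⁻¹ • w i s = 0 := by
      rw [← Finset.smul_sum]
      convert smul_zero _
      ext rb
      simp [w]
    rw [← hsum]
    refine (convex_convexHull ℝ _).sum_mem (fun _ _ => by positivity) ?_
      fun s _ => subset_convexHull ℝ _ ⟨s, rfl⟩
    simp
    field_simp
  obtain ⟨c, hc⟩ := colorful_caratheodory (by simpa using hcard) w hw
  obtain ⟨l, hl0, hl1, hl⟩ : ∃ l : ι → ℝ, (∀ i, 0 ≤ l i) ∧ ∑ i, l i = 1 ∧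
      ∑ i, l i • w i (c i) = 0 := by
    rw [convexHull_range_eq_exists_affineCombination] at hc
    obtain ⟨S, f, hf0, hf1, hf⟩ := hc
    rw [Finset.affineCombination_eq_linear_combination _ _ _ hf1] at hf
    refine ⟨fun i => if i ∈ S then f i else 0, fun i => ?_, ?_, ?_⟩
    · by_cases hi : i ∈ S
      · simpa [hi] using hf0 i hi
      · simp [hi]
    · simpa using hf1
    · simpa [ite_smul] using hf
  have hsame (s : Fin (K + 1)) (b : Option τ) :
      ∑ i with c i = s, l i * X i b = ∑ i with c i = 0, l i * X i b := by
    induction s using Fin.cases with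
    | zero => rfl
    | succ r =>
      have := congrArg (fun v : EuclideanSpace ℝ (Fin K × Option τ) => v (r, b)) hl
      simp only [w, WithLp.ofLp_sum, Finset.sum_apply, PiLp.smul_apply, smul_eq_mul, mul_sub,
        Finset.sum_sub_distrib, mul_ite, mul_zero, PiLp.zero_apply] at this
      rw [Finset.sum_filter, Finset.sum_filter]
      linarith
  have hmass (s : Fin (K + 1)) : ∑ i with c i = s, l i = ((K : ℝ) + 1)⁻¹ := by
    have h0 (s) : ∑ i with c i = s, l i = ∑ i with c i = 0, l i := by
      simpa [X] using hsame s none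
    have htot : ∑ s, ∑ i with c i = s, l i = 1 := by
      rw [Finset.sum_fiberwise, hl1]
    simp only [h0, Finset.sum_const, Finset.card_univ, Fintype.card_fin, nsmul_eq_mul] at htot
    push_cast at htot
    rw [h0, eq_inv_of_mul_eq_one_right htot]
  refine ⟨c, fun i => (K + 1) * l i, fun b => ∑ i with c i = 0, (K + 1) * l i * x i b,
    fun i => mul_nonneg (by positivity) (hl0 i), fun s => ?_, fun s b => ?_⟩
  · rw [← Finset.mul_sum, hmass, mul_inv_cancel₀ (by positivity)]
  · simp only [mul_assoc, ← Finset.mul_sum]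
    congr 1
    exact hsame s (some b)

open scoped InnerProductSpace in
/-- Greedy choice of orthonormal vectors with respect to which a family of symmetric operators has
a diagonal compression. -/
theorem exists_orthogonal_family {E : Type*} [NormedAddCommGroup E] [InnerProductSpace ℂ E]
    [FiniteDimensional ℂ E] {m : ℕ} (hm : 1 ≤ m) (T : Fin m → E →ₗ[ℂ] E)
    (hT : ∀ j, (T j).IsSymmetric) (N : ℕ) (hN : N * (m + 1) ≤ Module.finrank ℂ E)
    (hE : 1 ≤ Module.finrank ℂ E) :
    ∃ v : Fin (N + 1) → E, (∀ i, ‖v i‖ = 1) ∧ ∀ i l, i ≠ l →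
      ⟪v i, v l⟫_ℂ = 0 ∧ ∀ j, ⟪v i, T j (v l)⟫_ℂ = 0 := by
  suffices h : ∃ (v : Fin (N + 1) → E) (S : Submodule ℂ E),
      Module.finrank ℂ S + 1 ≤ (N + 1) * (m + 1) ∧
      (∀ i, v i ∈ S) ∧ (∀ i j, T j (v i) ∈ S) ∧ (∀ i, ‖v i‖ = 1) ∧ ∀ i l, i ≠ l →
      ⟪v i, v l⟫_ℂ = 0 ∧ ∀ j, ⟪v i, T j (v l)⟫_ℂ = 0 by
    obtain ⟨v, S, -, -, -, h1, h2⟩ := h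
    exact ⟨v, h1, h2⟩
  induction N with
  | zero =>
    have : Nontrivial E := Module.finrank_pos_iff.1 hE
    -- Starting from an eigenvector saves one dimension of `S`, so N(m+1) dimensions suffice for N+1
    -- vectors.
    obtain ⟨μ, hμ⟩ := Module.End.exists_eigenvalue (T ⟨0, hm⟩)
    obtain ⟨u, hu, hu0⟩ := hμ.exists_hasEigenvector
    rw [Module.End.mem_eigenspace_iff] at hu
    let e : E := ((‖u‖ : ℂ)⁻¹) • u
    have he : T ⟨0, hm⟩ e = μ • e := by simp only [e, map_smul, hu, smul_comm μ]
    let F : Fin m → E := fun j => if j = ⟨0, hm⟩ then e else T j e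
    refine ⟨fun _ => e, Submodule.span ℂ (Set.range F), ?_, fun _ => ?_, fun _ j => ?_, fun _ => ?_,
      fun i l hil => absurd (Subsingleton.elim (α := Fin 1) i l) hil⟩
    · have := finrank_range_le_card (R := ℂ) F
      simp only [Set.finrank, Fintype.card_fin] at this
      omega
    · exact Submodule.subset_span ⟨⟨0, hm⟩, by simp [F]⟩
    · by_cases hj : j = ⟨0, hm⟩
      · rw [hj, he]
        exact Submodule.smul_mem _ _ (Submodule.subset_span ⟨⟨0, hm⟩, by simp [F]⟩)
      · exact Submodule.subset_span ⟨j, by simp [F, hj]⟩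
    · simp [e, norm_smul, hu0]
  | succ N ih =>
    obtain ⟨v, S, hS, hvS, hTS, hv1, hv⟩ := ih (le_trans (by gcongr; omega) hN)
    have hperp : 0 < Module.finrank ℂ Sᗮ := by
      have := S.finrank_add_finrank_orthogonal
      omega
    have : Nontrivial Sᗮ := Module.finrank_pos_iff.1 hperp
    obtain ⟨e, he⟩ := exists_norm_eq Sᗮ (zero_le_one (α := ℝ))
    have heS (w : E) (hw : w ∈ S) : ⟪w, (e : E)⟫_ℂ = 0 := e.2 w hw
    let F : Option (Fin m) → E := fun j => j.elim (e : E) fun j => T j e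
    have h1 (i) : ⟪v i, (e : E)⟫_ℂ = 0 := heS _ (hvS i)
    have h2 (i j) : ⟪v i, T j e⟫_ℂ = 0 := by rw [← hT j]; exact heS _ (hTS i j)
    have h3 (i j) : ⟪(e : E), T j (v i)⟫_ℂ = 0 := inner_eq_zero_symm.1 (heS _ (hTS i j))
    refine ⟨Fin.cons (e : E) v, S ⊔ Submodule.span ℂ (Set.range F), ?_, ?_, ?_, ?_, ?_⟩
    · have := finrank_range_le_card (R := ℂ) F
      simp only [Set.finrank, Fintype.card_fin, Fintype.card_option] at this
      have h4 := Submodule.finrank_add_le_finrank_add_finrank S (Submodule.span ℂ (Set.range F))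
      have h5 : (N + 1 + 1) * (m + 1) = (N + 1) * (m + 1) + (m + 1) := by ring
      omega
    · refine Fin.cases ?_ fun i => Submodule.mem_sup_left (hvS i)
      exact Submodule.mem_sup_right (Submodule.subset_span ⟨none, rfl⟩)
    · refine Fin.cases (fun j => ?_) fun i j => Submodule.mem_sup_left (hTS i j)
      exact Submodule.mem_sup_right (Submodule.subset_span ⟨some j, rfl⟩)
    · exact Fin.cases he hv1
    · refine Fin.cases (Fin.cases (fun h => absurd rfl h) fun l _ => ?_)
        fun i => Fin.cases (fun _ => ?_) fun l hil => ?_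
      · exact ⟨inner_eq_zero_symm.1 (h1 l), h3 l⟩
      · exact ⟨h1 i, h2 i⟩
      · exact hv i l fun h => hil (congrArg Fin.succ h)

/-- An `m`-tuple of Hermitian matrices has a diagonal compression of size `N + 1` when the ambient
dimension is at least `N (m + 1)`. -/
theorem exists_diagonal_compression {m n : ℕ} (hm : 1 ≤ m) (hn : 1 ≤ n)
    (A : Fin m → Matrix (Fin n) (Fin n) ℂ) (hA : ∀ j, (A j).IsHermitian) (N : ℕ)
    (hN : N * (m + 1) ≤ n) :
    ∃ (X : Matrix (Fin n) (Fin (N + 1)) ℂ) (d : Fin (N + 1) → Fin m → ℝ), Xᴴ * X = 1 ∧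
      ∀ j, Xᴴ * A j * X = Matrix.diagonal fun i => (d i j : ℂ) := by
  obtain ⟨v, hv1, hv⟩ := exists_orthogonal_family hm (fun j => Matrix.toEuclideanLin (A j))
    (fun j => Matrix.isSymmetric_toEuclideanLin_iff.2 (hA j)) N (by simpa using hN) (by simpa using hn)
  let X : Matrix (Fin n) (Fin (N + 1)) ℂ := Matrix.of fun b i => v i b
  have hXA (B : Matrix (Fin n) (Fin n) ℂ) (i l) :
      (Xᴴ * B * X) i l = inner ℂ (v i) (Matrix.toEuclideanLin B (v l)) := by
    rw [EuclideanSpace.inner_eq_star_dotProduct, dotProduct_comm, Matrix.mul_assoc]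
    rfl
  have hX1 : Xᴴ * X = 1 := by
    ext i l
    have := hXA 1 i l
    rw [Matrix.mul_one] at this
    rw [this]
    have h1 : Matrix.toEuclideanLin (1 : Matrix (Fin n) (Fin n) ℂ) (v l) = v l := by
      simp [Matrix.toLpLin_one]
    rw [h1]
    by_cases h : i = l
    · subst h
      simp [hv1, inner_self_eq_norm_sq_to_K]
    · rw [Matrix.one_apply_ne h, (hv i l h).1]
  refine ⟨X, fun i j => ((Xᴴ * A j * X) i i).re, hX1, fun j => ?_⟩
  ext i l
  by_cases h : i = l
  · subst h
    rw [Matrix.diagonal_apply_eq]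
    exact ((Matrix.isHermitian_conjTranspose_mul_mul X (hA j)).coe_re_apply_self i).symm
  · rw [Matrix.diagonal_apply_ne _ h, hXA, (hv i l h).2 j]

/-- The joint rank `K + 1` numerical range of `m` Hermitian matrices of size at least
`K (m + 1)²` is non-empty. -/
theorem jointMatricialRange_one_nonempty {m n : ℕ} (hm : 1 ≤ m) (hn : 1 ≤ n)
    (A : Fin m → Matrix (Fin n) (Fin n) ℂ) (hA : ∀ j, (A j).IsHermitian) (K : ℕ)
    (hK : K * (m + 1) ^ 2 ≤ n) : (jointMatricialRange (K + 1) 1 A).Nonempty := by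
  obtain ⟨X, d, hX, hd⟩ := exists_diagonal_compression hm hn A hA (K * (m + 1))
    (by linarith [hK, pow_two (m + 1), mul_assoc K (m + 1) (m + 1)])
  obtain ⟨c, l, q, hl0, hl1, hq⟩ := tverberg K (by simp) d
  let Y : Matrix (Fin (K * (m + 1) + 1)) (Fin 1 × Fin (K + 1)) ℂ :=
    Matrix.of fun i s => if c i = s.2 then (Real.sqrt (l i) : ℂ) else 0
  have hY (f : Fin (K * (m + 1) + 1) → ℝ) (r : ℝ) (hr : ∀ s, ∑ i with c i = s, l i * f i = r) :
      Yᴴ * Matrix.diagonal (fun i => (f i : ℂ)) * Y = (r : ℂ) • 1 := by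
    ext ⟨a, s⟩ ⟨b, s'⟩
    obtain rfl := Subsingleton.elim a b
    rw [Matrix.mul_apply]
    simp only [Matrix.mul_diagonal, Matrix.conjTranspose_apply, Matrix.smul_apply, smul_eq_mul]
    by_cases h : s = s'
    · subst h
      rw [Matrix.one_apply_eq, mul_one, ← hr s, Finset.sum_filter]
      push_cast
      refine Finset.sum_congr rfl fun i _ => ?_
      by_cases hi : c i = s
      · have : (Real.sqrt (l i) : ℂ) * Real.sqrt (l i) = l i := by
          exact_mod_cast Real.mul_self_sqrt (hl0 i)
        simp only [Y, Matrix.of_apply, hi, if_true, RCLike.star_def, Complex.conj_ofReal]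
        push_cast
        rw [← this]
        ring
      · simp [Y, hi]
    · rw [Matrix.one_apply_ne (by simpa using h), mul_zero]
      refine Finset.sum_eq_zero fun i _ => ?_
      by_cases hi : c i = s
      · simp [Y, hi, h]
      · simp [Y, hi]
  refine ⟨scalarTuple 1 fun j => (q j : ℂ), fun j => ?_, X * Y, ?_, fun j => ?_⟩
  · exact Matrix.isDiag_smul_one _ _
  · have := hY (fun _ => 1) 1 (by simpa using hl1)
    rw [Matrix.conjTranspose_mul, Matrix.mul_assoc, ← Matrix.mul_assoc Xᴴ, hX, Matrix.one_mul]
    simpa using this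
  · have := hY (fun i => d i j) (q j) fun s => hq s j
    rw [← hd j] at this
    rw [scalarTuple, Matrix.smul_kronecker, Matrix.one_kronecker_one, ← this,
      Matrix.conjTranspose_mul]
    simp only [Matrix.mul_assoc]

/-- The kernel of a matrix contains orthonormal families of the expected size. -/
theorem exists_isometry_mul_eq_zero {ρ ν κ : Type*} [Fintype ρ] [Fintype ν] [Fintype κ]
    [DecidableEq ν] [DecidableEq κ] (L : Matrix ρ ν ℂ)
    (h : Fintype.card κ + Fintype.card ρ ≤ Fintype.card ν) :
    ∃ X : Matrix ν κ ℂ, Xᴴ * X = 1 ∧ L * X = 0 := by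
  let f := Matrix.toEuclideanLin L
  have hker : Fintype.card κ ≤ Module.finrank ℂ f.ker := by
    have h1 := f.finrank_range_add_finrank_ker
    have h2 := Submodule.finrank_le f.range
    rw [finrank_euclideanSpace] at h1 h2
    omega
  obtain ⟨g⟩ : Nonempty (κ ↪ Fin (Module.finrank ℂ f.ker)) :=
    Function.Embedding.nonempty_of_card_le (by simpa using hker)
  let b := stdOrthonormalBasis ℂ f.ker
  have hb : Orthonormal ℂ fun s : κ => (b (g s) : EuclideanSpace ℂ ν) :=
    (b.orthonormal.comp g g.injective).comp_linearIsometry f.ker.subtypeₗᵢ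
  refine ⟨Matrix.of fun i s => (b (g s) : EuclideanSpace ℂ ν) i, ?_, ?_⟩
  · ext s s'
    have := orthonormal_iff_ite.1 hb s s'
    rw [EuclideanSpace.inner_eq_star_dotProduct, dotProduct_comm] at this
    rw [Matrix.one_apply, ← this]
    rfl
  · ext r s
    have := LinearMap.mem_ker.1 (b (g s)).2
    exact congrArg (fun v : EuclideanSpace ℂ ρ => v r) this

/-- Inside a large joint eigen-compression one finds an isometry `W` with the same scalar
compressions which decouples from a given matrix `V`. -/
theorem exists_decoupled_isometry {m n p k : ℕ} (A : Fin m → Matrix (Fin n) (Fin n) ℂ)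
    {a : Fin m → ℂ} (ha : scalarTuple 1 a ∈ jointMatricialRange (k * p * (m + 2)) 1 A)
    (V : Matrix (Fin n) (Fin p × Fin k) ℂ) :
    ∃ W : Matrix (Fin n) (Fin p × Fin k) ℂ, Wᴴ * W = 1 ∧
      (∀ j, Wᴴ * A j * W = a j • 1) ∧ Vᴴ * W = 0 ∧ ∀ j, Vᴴ * A j * W = 0 := by
  obtain ⟨-, U, hU, hUA⟩ := ha
  let B : Option (Fin m) → Matrix (Fin n) (Fin n) ℂ := fun j => j.elim 1 A
  -- These are kp(m+1) equations in kp(m+2) unknowns, leaving a kernel of dimension at least kp.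
  obtain ⟨X, hX, hLX⟩ := exists_isometry_mul_eq_zero (κ := Fin p × Fin k)
    (Matrix.of fun (r : Option (Fin m) × (Fin p × Fin k)) s => (Vᴴ * B r.1 * U) r.2 s) (by
      simp only [Fintype.card_prod, Fintype.card_fin, Fintype.card_option]
      apply le_of_eq
      ring)
  have hB (j) : Vᴴ * B j * (U * X) = 0 := by
    ext r s
    rw [← Matrix.mul_assoc]
    exact congrFun (congrFun hLX (j, r)) s
  refine ⟨U * X, ?_, fun j => ?_, by simpa [B] using hB none, fun j => hB (some j)⟩
  · rw [Matrix.conjTranspose_mul, Matrix.mul_assoc, ← Matrix.mul_assoc Uᴴ, hU, Matrix.one_mul, hX]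
  · have : (U * X)ᴴ * A j * (U * X) = Xᴴ * (Uᴴ * A j * U) * X := by
      simp only [Matrix.conjTranspose_mul, Matrix.mul_assoc]
    rw [this, hUA, scalarTuple, Matrix.smul_kronecker, Matrix.one_kronecker_one]
    simp [hX]

theorem theorem2p5 (m n p k : ℕ) (hm : 1 ≤ m) (hp : 1 ≤ p) (hk : 1 ≤ k)
    (A : Fin m → Matrix (Fin n) (Fin n) ℂ) (hA : ∀ j, (A j).IsHermitian)
    (hn : (k * p * (m + 2) - 1) * (m + 1) ^ 2 ≤ n) :
    (jointMatricialRange (k * p * (m + 2)) 1 A).Nonempty ∧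
      ∀ a : Fin m → ℂ,
        scalarTuple 1 a ∈ jointMatricialRange (k * p * (m + 2)) 1 A →
          scalarTuple p a ∈ jointMatricialRange k p A ∧
            StarConvex ℝ (scalarTuple p a) (jointMatricialRange k p A) := by
  refine ⟨?_, fun a ha => ⟨?_, ?_⟩⟩
  · have hK : 2 ≤ k * p * (m + 2) :=
      le_trans (by omega) (Nat.le_mul_of_pos_left (m + 2) (Nat.mul_pos hk hp))
    have hn1 : 1 ≤ n := le_trans (Nat.mul_pos (by omega) (by positivity)) hn
    have := jointMatricialRange_one_nonempty hm hn1 A hA _ hn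
    rwa [Nat.sub_add_cancel (by omega)] at this
  -- With V = 0 the decoupling conditions are vacuous.
  · obtain ⟨W, hW, hWA, -⟩ := exists_decoupled_isometry A ha 0
    refine ⟨fun j => Matrix.isDiag_smul_one _ _, W, hW, fun j => ?_⟩
    rw [hWA, scalarTuple, Matrix.smul_kronecker, Matrix.one_kronecker_one]
  · rintro D ⟨hD, V, hV, hVA⟩ t u ht hu htu
    obtain ⟨W, hW, hWA, hVW, hVAW⟩ := exists_decoupled_isometry A ha V
    have hWV : Wᴴ * V = 0 := by
      simpa using congrArg Matrix.conjTranspose hVW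
    have hWAV (j) : Wᴴ * (A j * V) = 0 := by
      simpa [(hA j).eq] using congrArg Matrix.conjTranspose (hVAW j)
    have htt : (Real.sqrt t : ℂ) * Real.sqrt t = t := by exact_mod_cast Real.mul_self_sqrt ht
    have huu : (Real.sqrt u : ℂ) * Real.sqrt u = u := by exact_mod_cast Real.mul_self_sqrt hu
    simp only [Matrix.mul_assoc] at hWA hVA hVAW
    refine ⟨fun j => ?_, (Real.sqrt t : ℂ) • W + (Real.sqrt u : ℂ) • V, ?_, fun j => ?_⟩
    · exact ((Matrix.isDiag_smul_one _ (a j)).smul t).add ((hD j).smul u)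
    · simp [Matrix.add_mul, Matrix.mul_add, Matrix.conjTranspose_smul, hW, hV, hWV, hVW, smul_smul,
        ← add_smul, Real.mul_self_sqrt ht, Real.mul_self_sqrt hu, htu]
    · simp only [Matrix.conjTranspose_add, Matrix.conjTranspose_smul, RCLike.star_def,
        Complex.conj_ofReal, Matrix.add_mul, Matrix.mul_add, Matrix.smul_mul, Matrix.mul_smul,
        Matrix.mul_assoc, hWA, hVA, hVAW, hWAV, smul_smul, smul_zero, add_zero, zero_add, huu]
      simp only [← mul_assoc, htt]
      simp [scalarTuple, Matrix.add_kronecker, Matrix.smul_kronecker, mul_smul]
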